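/- Let $K$ be an algebraically closed field (for instance $\mathbb{C}$), and let $F,G\in K[x,y,z]$ be forms of degree $3$, spanning the pencil of cubic curves $P(C):\ F-C\,G=0$ in the projective plane over $K$. Write $I_p$ for the intersection number of two curves at a point $p$. Suppose that the base-points of the pencil, i.e. the common zeros of $F$ and $G$, are $b_0,b_1,\dots,b_5$, where - $b_0$ is a double point of both $F=0$ and $G=0$, and $I_{b_0}(F,G)=4$; - $b_1,\dots,b_5$ are simple base-points, i.e. simple points of $P(C)$ for all but finitely many $C$; they are listed with multiplicity, each point $p$ occurring exactly $I_p(F,G)$ times among $b_1,\dots,b_5$. So some of them may coincide, namely when the curves of the pencil are tangent to each other there, and there are then fewer simple base-points. Let $Q$ be a plane curve such that at no simple base-point is $Q$ tangent to all but finitely many of the curves $P(C)$ (this is a restriction only at simple base-points where the curves of the pencil are tangent to each other). Suppose that one of the following holds, where base-points are now counted as distinct points: 1. $\deg Q=1$, and $b_0$ is the only base-point on $Q$ (and is a simple point of $Q$); 2. $\deg Q=1$, and exactly two base-points lie on $Q$, both of them simple base-points (and simple points of $Q$); 3. $\deg Q=2$, and exactly four base-points lie on $Q$, one of them $b_0$,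 and all four are simple points of $Q$; 4. $\deg Q=3$, $b_0$ is a double point of $Q$, and exactly four other base-points lie on $Q$, all of them simple points of $Q$. Then $Q$ is an involution curve for the pencil: for all but finitely many $C\in K$, the sum of $I_p(Q,P(C))$ over all base-points $p$ of the pencil equals $3\deg(Q)-1$. -/

import Mathlib

open MvPolynomial Filter
open scoped LinearAlgebra.Projectivization

noncomputable section

/-- The projective plane over `K`. -/
abbrev Plane (K : Type*) [Field K] : Type _ := ℙ K (Fin 3 → K)

/-- A projective plane curve over `K`: a nonzero form in three variables, with its degree. -/
structure PlaneCurve (K : Type*) [Field K] where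
  degree : ℕ
  form : MvPolynomial (Fin 3) K
  isHomogeneous : form.IsHomogeneous degree
  ne_zero : form ≠ 0

section Local

variable {K : Type*} [Field K]

theorem Plane.exists_rep_ne_zero (p : Plane K) : ∃ i, p.rep i ≠ 0 :=
  Function.ne_iff.mp p.rep_nonzero

/-- The index of a coordinate that does not vanish at `p`; it selects the affine chart
in which the curves are studied near `p`. -/
def Plane.chart (p : Plane K) : Fin 3 := p.exists_rep_ne_zero.choose

/-- The two affine coordinates of `p` in its chart. -/
def Plane.affineCoord (p : Plane K) : Fin 2 → K :=
  fun j => p.rep (p.chart.succAbove j) / p.rep p.chart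

/-- The affine equation of the curve `f = 0` in the chart of `p`: the coordinate that belongs to
the chart is set to `1`. -/
def localEquation (p : Plane K) : MvPolynomial (Fin 3) K →ₐ[K] MvPolynomial (Fin 2) K :=
  aeval (p.chart.insertNth (1 : MvPolynomial (Fin 2) K) X)

/-- The (maximal) ideal of all polynomials in the affine coordinates that vanish at `p`. -/
def pointIdeal (p : Plane K) : Ideal (MvPolynomial (Fin 2) K) :=
  RingHom.ker (eval p.affineCoord)

instance pointIdeal_isPrime (p : Plane K) : (pointIdeal p).IsPrime :=
  RingHom.ker_isPrime _

/-- The local ring of the plane at `p`. -/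
abbrev LocalRingAt (p : Plane K) : Type _ := Localization.AtPrime (pointIdeal p)

/-- The intersection number at `p` of the curves `f = 0` and `g = 0`: the `K`-dimension of the
local ring at `p` modulo the local equations of the two curves (`⊤` if this is infinite). -/
def intersectionNumber (f g : MvPolynomial (Fin 3) K) (p : Plane K) : ℕ∞ :=
  Cardinal.toENat (Module.rank K (LocalRingAt p ⧸
    (Ideal.span {algebraMap _ (LocalRingAt p) (localEquation p f),
      algebraMap _ (LocalRingAt p) (localEquation p g)} : Ideal (LocalRingAt p))))

/-- The curve `f = 0` passes through `p`. -/
def PassesThrough (f : MvPolynomial (Fin 3) K) (p : Plane K) : Prop :=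
  eval p.rep f = 0

/-- The point `p` has multiplicity exactly `k` on the curve `f = 0`: the Taylor expansion of the
local equation at `p` starts in degree `k`. -/
def HasMultiplicity (f : MvPolynomial (Fin 3) K) (p : Plane K) (k : ℕ) : Prop :=
  localEquation p f ∈ pointIdeal p ^ k ∧ localEquation p f ∉ pointIdeal p ^ (k + 1)

/-- `p` is a simple (nonsingular) point on the curve `f = 0`. -/
def IsSimplePoint (f : MvPolynomial (Fin 3) K) (p : Plane K) : Prop := HasMultiplicity f p 1

/-- `p` is a double point on the curve `f = 0`. -/
def IsDoublePoint (f : MvPolynomial (Fin 3) K) (p : Plane K) : Prop := HasMultiplicity f p 2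

/-- The curves `f = 0` and `g = 0` are tangent at `p`: `p` is a simple point on both and they have
the same tangent line there, i.e. the linear terms at `p` are proportional. -/
def TangentAt (f g : MvPolynomial (Fin 3) K) (p : Plane K) : Prop :=
  IsSimplePoint f p ∧ IsSimplePoint g p ∧
    ∃ c : K, localEquation p f - c • localEquation p g ∈ pointIdeal p ^ 2

/-- The member with parameter `c` of the pencil spanned by `F` and `G`. -/
def pencilMember (F G : MvPolynomial (Fin 3) K) (c : K) : MvPolynomial (Fin 3) K := F - c • G

/-- The base-points of the pencil: the common zeros of `F` and `G`. -/
def basePoints (F G : MvPolynomial (Fin 3) K) : Set (Plane K) :=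
  {p | PassesThrough F p ∧ PassesThrough G p}

/-- `Q` is tangent at `p` to the pencil, i.e. to all but finitely many of its members. (For a base
point `p` this forces the general members of the pencil to be tangent to each other at `p`.) -/
def TangentToPencilAt (F G : MvPolynomial (Fin 3) K) (Q : PlaneCurve K) (p : Plane K) : Prop :=
  ∀ᶠ c in cofinite, TangentAt Q.form (pencilMember F G c) p

/-- `Q` is an involution curve for the cubic pencil spanned by `F` and `G`: for the general member
(all but finitely many parameters), the intersection numbers of `Q` with the member at the
base-points of the pencil add up to `3 * deg Q - 1`. -/
def IsInvolutionCurve (F G : MvPolynomial (Fin 3) K) (Q : PlaneCurve K) : Prop :=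
  ∀ᶠ c in cofinite,
    (∑ᶠ p ∈ basePoints F G, intersectionNumber Q.form (pencilMember F G c) p) + 1
      = ((3 * Q.degree : ℕ) : ℕ∞)

/-- `F` and `G` span a pencil of cubic curves with one double base-point `b₀` and simple base-points
`b 0, …, b 4`, some of which may coincide. The base-points are counted with multiplicity:
`b₀`, a double point of `F = 0` and of `G = 0`, counts for `2 * 2 = 4`, and a simple base-point is
listed as often as its intersection number says (more than once exactly when the curves of the
pencil are tangent there). -/
structure IsDoublePointPencil (F G : MvPolynomial (Fin 3) K) (b₀ : Plane K) (b : Fin 5 → Plane K) :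
    Prop where
  isHomogeneous_left : F.IsHomogeneous 3
  isHomogeneous_right : G.IsHomogeneous 3
  basePoints_eq : basePoints F G = insert b₀ (Set.range b)
  double_left : IsDoublePoint F b₀
  double_right : IsDoublePoint G b₀
  intersectionNumber_double : intersectionNumber F G b₀ = 4
  simple : ∀ i, ∀ᶠ c in cofinite, IsSimplePoint (pencilMember F G c) (b i)
  intersectionNumber_simple :
    ∀ i, intersectionNumber F G (b i) = ((Set.ncard {j | b j = b i} : ℕ) : ℕ∞)

/-- The base-points of the pencil that lie on `Q`. -/
def basePointsOn (F G : MvPolynomial (Fin 3) K) (Q : PlaneCurve K) : Set (Plane K) :=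
  {p ∈ basePoints F G | PassesThrough Q.form p}

end Local

end

/-! At each base-point on `Q`, the general member meets `Q` with intersection number equal to the
product of the two multiplicities, because they have no common tangent there. The contributions at
`b₀` and at the simple base-points then add up in each case to `3 * Q.degree - 1`.

At `b₀`, a common tangent of `F` and `G` would force intersection number at least 5
(`five_le_of_common_tangent`). So in each tangent direction of `Q` the quadratic part of `F - c G`
vanishes for at most one `c`. At a simple base-point on `Q`, if the linear parts of `F` and `G` both
vanished along the tangent of `Q`, then `Q` would be tangent to the pencil.

The local statement is linear algebra on Taylor coefficients. Without common tangents the resultant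
of the leading forms is nonzero, whence `m ^ n ≤ I ⊔ m ^ (n + 1)` for the ideal `I` of the two
equations (the `pow_le_of_*` lemmas). By Nakayama the local ring modulo `I` is the polynomial ring
modulo `I ⊔ m ^ n` (`toENat_rank_quotient_eq`), whose dimension is a count of monomials
(`toENat_rank_quotient_sup_pow`). -/

noncomputable section

/-! ### Localizing at a maximal ideal, modulo its powers -/

section Localization

variable {K A : Type*} [Field K] [CommRing A] [Algebra K A] (m : Ideal A) [m.IsMaximal]

/-- A prime containing `m ^ n` contains `m`, hence equals it by maximality. So `s` lies in no
maximal ideal of the quotient and is a unit there. -/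
theorem exists_mul_sub_one_mem_pow {s : A} (hs : s ∉ m) (n : ℕ) : ∃ t, s * t - 1 ∈ m ^ n := by
  have h : IsUnit (Ideal.Quotient.mk (m ^ n) s) := by
    by_contra hu
    obtain ⟨M, hM, hsM⟩ := exists_max_ideal_of_mem_nonunits hu
    have hle : m ^ n ≤ M.comap (Ideal.Quotient.mk (m ^ n)) := fun x hx => by
      rw [Ideal.mem_comap, Ideal.Quotient.eq_zero_iff_mem.mpr hx]
      exact M.zero_mem
    have hp : (M.comap (Ideal.Quotient.mk (m ^ n))).IsPrime := Ideal.comap_isPrime _ _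
    have hm : m ≤ M.comap (Ideal.Quotient.mk (m ^ n)) := hp.le_of_pow_le hle
    exact hs ((inferInstance : m.IsMaximal).eq_of_le hp.ne_top hm ▸ Ideal.mem_comap.mpr hsM)
  obtain ⟨t, ht⟩ := h.exists_right_inv
  obtain ⟨t, rfl⟩ := Ideal.Quotient.mk_surjective t
  exact ⟨t, by rw [← Ideal.Quotient.eq_zero_iff_mem]; simp [ht]⟩

theorem mem_of_algebraMap_mem_map {B : Ideal A} {n : ℕ} (hB : m ^ n ≤ B) {a : A}
    (ha : algebraMap A (Localization.AtPrime m) a ∈ B.map (algebraMap A (Localization.AtPrime m))) :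
    a ∈ B := by
  rw [IsLocalization.algebraMap_mem_map_algebraMap_iff m.primeCompl] at ha
  obtain ⟨s, hs, hsa⟩ := ha
  obtain ⟨t, ht⟩ := exists_mul_sub_one_mem_pow m hs n
  have : a = t * (s * a) - a * (s * t - 1) := by ring
  rw [this]
  exact B.sub_mem (B.mul_mem_left _ hsa) (B.mul_mem_left _ (hB ht))

theorem exists_algebraMap_sub_mem_map {B : Ideal A} {n : ℕ} (hB : m ^ n ≤ B)
    (r : Localization.AtPrime m) :
    ∃ a, algebraMap A (Localization.AtPrime m) a - r ∈
      B.map (algebraMap A (Localization.AtPrime m)) := by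
  obtain ⟨a, s, rfl⟩ := IsLocalization.exists_mk'_eq m.primeCompl r
  obtain ⟨t, ht⟩ := exists_mul_sub_one_mem_pow m s.2 n
  refine ⟨a * t, ?_⟩
  have h : algebraMap A (Localization.AtPrime m) (a * t) - IsLocalization.mk' _ a s =
      IsLocalization.mk' _ a s * algebraMap A _ (s * t - 1) := by
    have := IsLocalization.mk'_spec (Localization.AtPrime m) a s
    rw [map_mul, ← this]
    simp only [map_sub, map_mul, map_one]
    ring
  rw [h]
  exact Ideal.mul_mem_left _ _ (Ideal.mem_map_of_mem _ (hB ht))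

/-- Modulo an ideal that contains a power of the maximal ideal, localizing changes nothing. -/
def quotientEquivLocalization {B : Ideal A} {n : ℕ} (hB : m ^ n ≤ B) :
    (A ⧸ B) ≃ₗ[K]
      (Localization.AtPrime m ⧸ B.map (algebraMap A (Localization.AtPrime m))) :=
  LinearEquiv.ofBijective
    (Ideal.quotientMapₐ (R₁ := K) (B.map (algebraMap A (Localization.AtPrime m)))
      (IsScalarTower.toAlgHom K A (Localization.AtPrime m)) Ideal.le_comap_map).toLinearMap (by
    constructor
    · rw [← LinearMap.ker_eq_bot, LinearMap.ker_eq_bot']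
      intro x
      obtain ⟨a, rfl⟩ := Ideal.Quotient.mk_surjective x
      intro hx
      refine Ideal.Quotient.eq_zero_iff_mem.mpr (mem_of_algebraMap_mem_map m hB ?_)
      exact Ideal.Quotient.eq_zero_iff_mem.mp hx
    · intro x
      obtain ⟨r, rfl⟩ := Ideal.Quotient.mk_surjective x
      obtain ⟨a, ha⟩ := exists_algebraMap_sub_mem_map m hB r
      exact ⟨Ideal.Quotient.mk _ a, Ideal.Quotient.eq.mpr ha⟩)

/-- Truncating at any order bounds the local dimension from below, with no finiteness assumed. -/
theorem toENat_rank_quotient_le (I : Ideal A) (n : ℕ) :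
    Cardinal.toENat (Module.rank K (A ⧸ (I ⊔ m ^ n))) ≤
      Cardinal.toENat (Module.rank K
        (Localization.AtPrime m ⧸ I.map (algebraMap A (Localization.AtPrime m)))) := by
  rw [(quotientEquivLocalization (K := K) m (B := I ⊔ m ^ n) (n := n) le_sup_right).rank_eq]
  refine OrderHomClass.mono Cardinal.toENat ?_
  have hle : I.map (algebraMap A (Localization.AtPrime m)) ≤ (I ⊔ m ^ n).map _ :=
    Ideal.map_mono le_sup_left
  exact LinearMap.rank_le_of_surjective
    (Ideal.Quotient.factorₐ K hle).toLinearMap (Ideal.Quotient.factor_surjective hle)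

/-- Nakayama's lemma in the local ring, applied to the finitely generated ideal `m ^ n`. -/
theorem map_pow_le_map_of_le [IsNoetherianRing A] {I : Ideal A} {n : ℕ}
    (h : m ^ n ≤ I ⊔ m ^ (n + 1)) :
    (m ^ n).map (algebraMap A (Localization.AtPrime m)) ≤
      I.map (algebraMap A (Localization.AtPrime m)) := by
  refine Submodule.le_of_le_smul_of_le_jacobson_bot
    (I := IsLocalRing.maximalIdeal (Localization.AtPrime m))
    (((isNoetherianRing_iff_ideal_fg A).mp inferInstance (m ^ n)).map _)
    (IsLocalRing.maximalIdeal_le_jacobson _) ?_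
  rw [smul_eq_mul, ← Localization.AtPrime.map_eq_maximalIdeal, ← Ideal.map_mul, ← pow_succ',
    ← Ideal.map_sup]
  exact Ideal.map_mono h

theorem toENat_rank_quotient_eq [IsNoetherianRing A] {I : Ideal A} {n : ℕ}
    (h : m ^ n ≤ I ⊔ m ^ (n + 1)) :
    Cardinal.toENat (Module.rank K
        (Localization.AtPrime m ⧸ I.map (algebraMap A (Localization.AtPrime m)))) =
      Cardinal.toENat (Module.rank K (A ⧸ (I ⊔ m ^ n))) := by
  rw [(quotientEquivLocalization (K := K) m (B := I ⊔ m ^ n) (n := n) le_sup_right).rank_eq,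
    Ideal.map_sup, sup_eq_left.mpr (map_pow_le_map_of_le m h)]

end Localization

/-! ### Dimensions of quotients through linear maps -/

section Dimension

variable {K A V : Type*} [Field K] [CommRing A] [Algebra K A] [AddCommGroup V] [Module K V]
  [FiniteDimensional K V]

/-- `T` induces a surjection of quotients. It need only be `K`-linear, so it can be a list of Taylor
coefficients. -/
theorem finrank_quotient_le_toENat_rank (T : A →ₗ[K] V) (hT : Function.Surjective T) (B : Ideal A)
    (S : Submodule K V) (h : ∀ a ∈ B, T a ∈ S) :
    ((Module.finrank K (V ⧸ S) : ℕ) : ℕ∞) ≤ Cardinal.toENat (Module.rank K (A ⧸ B)) := by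
  have hs : Function.Surjective ((B.restrictScalars K).mapQ S T h) := by
    intro x
    obtain ⟨v, rfl⟩ := Submodule.mkQ_surjective _ x
    obtain ⟨a, rfl⟩ := hT v
    exact ⟨Submodule.Quotient.mk a, rfl⟩
  have h1 := LinearMap.lift_rank_le_of_surjective _ hs
  rw [← Module.finrank_eq_rank] at h1
  have h2 := OrderHomClass.mono Cardinal.toENat h1
  simp only [Cardinal.lift_natCast, map_natCast, Cardinal.toENat_lift] at h2
  exact h2

theorem toENat_rank_eq_finrank_quotient (T : A →ₗ[K] V) (hT : Function.Surjective T) (B : Ideal A)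
    (S : Submodule K V) (h : ∀ a, a ∈ B ↔ T a ∈ S) :
    Cardinal.toENat (Module.rank K (A ⧸ B)) = ((Module.finrank K (V ⧸ S) : ℕ) : ℕ∞) := by
  refine le_antisymm ?_ (finrank_quotient_le_toENat_rank T hT B S fun a => (h a).mp)
  have hs : Function.Injective ((B.restrictScalars K).mapQ S T fun a => (h a).mp) := by
    rw [← LinearMap.ker_eq_bot, LinearMap.ker_eq_bot']
    intro x
    obtain ⟨a, rfl⟩ := Submodule.mkQ_surjective _ x
    intro hx
    exact (Submodule.Quotient.mk_eq_zero _).mpr ((h a).mpr ((Submodule.Quotient.mk_eq_zero _).mp hx))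
  have h1 := LinearMap.lift_rank_le_of_injective _ hs
  rw [← Module.finrank_eq_rank K (V ⧸ S)] at h1
  have h2 := OrderHomClass.mono Cardinal.toENat h1
  simp only [Cardinal.lift_natCast, map_natCast, Cardinal.toENat_lift] at h2
  exact h2

/-- A linear system modulo `B` is solved by the inverse matrix. Below, `M` is a Sylvester matrix and
the `w j` are the monomials of one degree. -/
theorem mem_of_det_ne_zero {ι : Type*} [Fintype ι] [DecidableEq ι] (M : Matrix ι ι K)
    (hM : M.det ≠ 0) (B : Ideal A) (w : ι → A) (h : ∀ i, ∑ j, M i j • w j ∈ B) (j : ι) :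
    w j ∈ B := by
  have hinv : M⁻¹ * M = 1 := Matrix.nonsing_inv_mul M (isUnit_iff_ne_zero.mpr hM)
  have : w j = ∑ i, M⁻¹ j i • ∑ k, M i k • w k := by
    simp only [Finset.smul_sum, smul_smul]
    rw [Finset.sum_comm]
    simp only [← Finset.sum_smul, ← Matrix.mul_apply, hinv, Matrix.one_apply, ite_smul, one_smul,
      zero_smul, Finset.sum_ite_eq, Finset.mem_univ, if_true]
  rw [this]
  exact B.sum_mem fun i _ => Submodule.smul_of_tower_mem B _ (h i)

end Dimension

/-! ### Taylor coefficients at a point -/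

section Jets

variable {K : Type*} [Field K] (a : Fin 2 → K)

/-- The translation that moves the point `a` to the origin. -/
def shiftEquiv : MvPolynomial (Fin 2) K ≃ₐ[K] MvPolynomial (Fin 2) K :=
  AlgEquiv.ofAlgHom (aeval fun i => X i + C (a i)) (aeval fun i => X i - C (a i))
    (by ext i : 1; simp) (by ext i : 1; simp)

theorem constantCoeff_shiftEquiv (f : MvPolynomial (Fin 2) K) :
    constantCoeff (shiftEquiv a f) = eval a f := by
  have : (constantCoeff.comp (shiftEquiv a).toRingHom : MvPolynomial (Fin 2) K →+* K) = eval a := by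
    ext i <;> simp [shiftEquiv]
  exact congrArg (fun φ => φ f) this

/-- The exponent of the monomial `X₀ ^ i * X₁ ^ j`. -/
def exponent (i j : ℕ) : Fin 2 →₀ ℕ := Finsupp.single 0 i + Finsupp.single 1 j

theorem exponent_inj {i j k l : ℕ} : exponent i j = exponent k l ↔ i = k ∧ j = l := by
  simp [exponent, Finsupp.ext_iff, Fin.forall_fin_two]

theorem exponent_apply (d : Fin 2 →₀ ℕ) : exponent (d 0) (d 1) = d := by
  simp [exponent, Finsupp.ext_iff, Fin.forall_fin_two]

theorem degree_exponent (i j : ℕ) : (exponent i j).degree = i + j := by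
  simp [exponent, Finsupp.degree_eq_sum, Fin.sum_univ_two]

/-- The coefficient of `(X₀ - a₀) ^ i * (X₁ - a₁) ^ j` in the Taylor expansion at `a`. -/
def jet (i j : ℕ) : MvPolynomial (Fin 2) K →ₗ[K] K :=
  lcoeff K (exponent i j) ∘ₗ (shiftEquiv a).toLinearMap

/-- The monomial `(X₀ - a₀) ^ i * (X₁ - a₁) ^ j`. -/
def shiftedMonomial (i j : ℕ) : MvPolynomial (Fin 2) K :=
  (X 0 - C (a 0)) ^ i * (X 1 - C (a 1)) ^ j

theorem shiftEquiv_shiftedMonomial (i j : ℕ) :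
    shiftEquiv a (shiftedMonomial a i j) = monomial (exponent i j) 1 := by
  have h : monomial (exponent i j) (1 : K) = X 0 ^ i * X 1 ^ j := by
    rw [X_pow_eq_monomial, X_pow_eq_monomial, monomial_mul, one_mul, exponent]
  rw [h]
  simp [shiftEquiv, shiftedMonomial]

theorem jet_shiftedMonomial (i j k l : ℕ) :
    jet a i j (shiftedMonomial a k l) = if k = i ∧ l = j then 1 else 0 := by
  simp [jet, shiftEquiv_shiftedMonomial, coeff_monomial, exponent_inj]

theorem shiftedMonomial_mul (i j k l : ℕ) :
    shiftedMonomial a i j * shiftedMonomial a k l = shiftedMonomial a (i + k) (j + l) := by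
  simp only [shiftedMonomial]; ring

theorem ker_eval_eq_comap :
    RingHom.ker (eval a) = (idealOfVars (Fin 2) K).comap (shiftEquiv a).toRingEquiv := by
  ext f
  rw [RingHom.mem_ker, ← constantCoeff_shiftEquiv, Ideal.mem_comap,
    ← pow_one (idealOfVars (Fin 2) K), mem_pow_idealOfVars_iff']
  simp only [Nat.lt_one_iff, Finsupp.degree_eq_zero_iff, forall_eq]
  rfl

/-- After translation to the origin, this is the description of powers of the ideal of the variables
by coefficients. No derivatives occur, so the characteristic plays no role. -/
theorem mem_ker_eval_pow_iff {n : ℕ} {f : MvPolynomial (Fin 2) K} :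
    f ∈ RingHom.ker (eval a) ^ n ↔ ∀ i j, i + j < n → jet a i j f = 0 := by
  have h : RingHom.ker (eval a) ^ n =
      (idealOfVars (Fin 2) K ^ n).comap (shiftEquiv a).toRingEquiv := by
    rw [ker_eval_eq_comap, ← Ideal.map_symm, ← Ideal.map_symm, Ideal.map_pow]
  rw [h, Ideal.mem_comap, mem_pow_idealOfVars_iff']
  constructor
  · intro hf i j hij
    exact hf (exponent i j) (by rwa [degree_exponent])
  · intro hf d hd
    rw [← exponent_apply d, degree_exponent] at hd
    have := hf _ _ hd
    rwa [jet, exponent_apply] at this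

theorem jet_zero_zero (f : MvPolynomial (Fin 2) K) : jet a 0 0 f = eval a f := by
  rw [← constantCoeff_shiftEquiv]
  simp [jet, exponent, constantCoeff_eq]

theorem jet_eq_zero_of_mem {n : ℕ} {f : MvPolynomial (Fin 2) K}
    (hf : f ∈ RingHom.ker (eval a) ^ n) {i j : ℕ} (h : i + j < n) : jet a i j f = 0 :=
  (mem_ker_eval_pow_iff a).mp hf i j h

theorem shiftedMonomial_mem (i j : ℕ) :
    shiftedMonomial a i j ∈ RingHom.ker (eval a) ^ (i + j) := by
  rw [mem_ker_eval_pow_iff]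
  intro k l hkl
  rw [jet_shiftedMonomial, if_neg (by omega)]

/-- The homogeneous part of degree `n` in the Taylor expansion at `a`. -/
def taylorPart (n : ℕ) (f : MvPolynomial (Fin 2) K) : MvPolynomial (Fin 2) K :=
  ∑ k ∈ Finset.HasAntidiagonal.antidiagonal n, jet a k.1 k.2 f • shiftedMonomial a k.1 k.2

/-- A polynomial vanishing to order `n` agrees with its leading form up to order `n + 1`. -/
theorem sub_taylorPart_mem {n : ℕ} {f : MvPolynomial (Fin 2) K}
    (hf : f ∈ RingHom.ker (eval a) ^ n) :
    f - taylorPart a n f ∈ RingHom.ker (eval a) ^ (n + 1) := by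
  rw [mem_ker_eval_pow_iff]
  intro i j hij
  simp only [taylorPart, map_sub, map_sum, map_smul, jet_shiftedMonomial, smul_eq_mul, mul_ite,
    mul_one, mul_zero]
  rcases Nat.lt_succ_iff_lt_or_eq.mp hij with h | h
  · rw [jet_eq_zero_of_mem a hf h, Finset.sum_eq_zero, sub_zero]
    rintro ⟨k, l⟩ hkl
    rw [Finset.HasAntidiagonal.mem_antidiagonal] at hkl
    exact if_neg (by simp only at hkl ⊢; omega)
  · rw [Finset.sum_eq_single (i, j)]
    · simp
    · rintro ⟨k, l⟩ _ hkl
      exact if_neg (by simpa using hkl)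
    · intro hn
      exact absurd (Finset.HasAntidiagonal.mem_antidiagonal.mpr h) hn

theorem pow_le_of_shiftedMonomial_mem {n : ℕ} {B : Ideal (MvPolynomial (Fin 2) K)}
    (hB : RingHom.ker (eval a) ^ (n + 1) ≤ B)
    (h : ∀ k ∈ Finset.HasAntidiagonal.antidiagonal n, shiftedMonomial a k.1 k.2 ∈ B) :
    RingHom.ker (eval a) ^ n ≤ B := by
  intro f hf
  have h1 : taylorPart a n f ∈ B :=
    B.sum_mem fun k hk => Submodule.smul_of_tower_mem B _ (h k hk)
  simpa using B.add_mem (hB (sub_taylorPart_mem a hf)) h1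

theorem taylorPart_mem (n : ℕ) (f : MvPolynomial (Fin 2) K) :
    taylorPart a n f ∈ RingHom.ker (eval a) ^ n :=
  Ideal.sum_mem _ fun k hk => Submodule.smul_of_tower_mem _ _ (by
    rw [← Finset.HasAntidiagonal.mem_antidiagonal.mp hk]
    exact shiftedMonomial_mem a k.1 k.2)

/-- Monomial multiples of `f` lie in `I` and agree with those of its leading form up to higher
order. This supplies the rows of the Sylvester matrices. -/
theorem shiftedMonomial_mul_taylorPart_mem {n : ℕ} {f : MvPolynomial (Fin 2) K}
    (hf : f ∈ RingHom.ker (eval a) ^ n) {I : Ideal (MvPolynomial (Fin 2) K)} (hI : f ∈ I)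
    (i j : ℕ) :
    shiftedMonomial a i j * taylorPart a n f ∈ I ⊔ RingHom.ker (eval a) ^ (i + j + (n + 1)) := by
  have h : shiftedMonomial a i j * taylorPart a n f =
      shiftedMonomial a i j * f - shiftedMonomial a i j * (f - taylorPart a n f) := by ring
  rw [h, pow_add]
  exact Ideal.sub_mem _ (Ideal.mem_sup_left (I.mul_mem_left _ hI)) (Ideal.mem_sup_right
    (Ideal.mul_mem_mul (shiftedMonomial_mem a i j) (sub_taylorPart_mem a hf)))

/-- The value at `(v, w)` of the homogeneous part of degree `n` in the Taylor expansion at `a`. -/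
def taylorValue (n : ℕ) (v w : K) : MvPolynomial (Fin 2) K →ₗ[K] K :=
  ∑ k ∈ Finset.HasAntidiagonal.antidiagonal n, (v ^ k.1 * w ^ k.2) • jet a k.1 k.2

theorem taylorValue_apply (n : ℕ) (v w : K) (f : MvPolynomial (Fin 2) K) :
    taylorValue a n v w f =
      ∑ k ∈ Finset.HasAntidiagonal.antidiagonal n, v ^ k.1 * w ^ k.2 * jet a k.1 k.2 f := by
  simp [taylorValue]

theorem taylorValue_shiftedMonomial (n : ℕ) (v w : K) (i j : ℕ) :
    taylorValue a n v w (shiftedMonomial a i j) = if i + j = n then v ^ i * w ^ j else 0 := by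
  rw [taylorValue_apply]
  simp only [jet_shiftedMonomial, mul_ite, mul_one, mul_zero]
  split_ifs with h
  · rw [Finset.sum_eq_single (i, j)]
    · simp
    · rintro ⟨k, l⟩ _ hkl
      refine if_neg fun hh => hkl ?_
      rw [hh.1, hh.2]
    · intro hn
      exact absurd (Finset.HasAntidiagonal.mem_antidiagonal.mpr h) hn
  · refine Finset.sum_eq_zero fun k hk => if_neg fun hh => h ?_
    rw [hh.1, hh.2, Finset.HasAntidiagonal.mem_antidiagonal.mp hk]

theorem taylorValue_eq_zero {n : ℕ} {f : MvPolynomial (Fin 2) K}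
    (hf : f ∈ RingHom.ker (eval a) ^ (n + 1)) (v w : K) : taylorValue a n v w f = 0 := by
  rw [taylorValue_apply]
  refine Finset.sum_eq_zero fun k hk => ?_
  rw [jet_eq_zero_of_mem a hf, mul_zero]
  rw [Finset.HasAntidiagonal.mem_antidiagonal.mp hk]
  exact Nat.lt_succ_self n

theorem taylorValue_mul {m n : ℕ} {f g : MvPolynomial (Fin 2) K}
    (hf : f ∈ RingHom.ker (eval a) ^ m) (hg : g ∈ RingHom.ker (eval a) ^ n) (v w : K) :
    taylorValue a (m + n) v w (f * g) = taylorValue a m v w f * taylorValue a n v w g := by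
  have h : f * g = (f - taylorPart a m f) * g + taylorPart a m f * (g - taylorPart a n g) +
      taylorPart a m f * taylorPart a n g := by ring
  have h1 : (f - taylorPart a m f) * g ∈ RingHom.ker (eval a) ^ (m + n + 1) := by
    rw [show m + n + 1 = m + 1 + n by ring, pow_add]
    exact Ideal.mul_mem_mul (sub_taylorPart_mem a hf) hg
  have h2 : taylorPart a m f * (g - taylorPart a n g) ∈ RingHom.ker (eval a) ^ (m + n + 1) := by
    rw [add_assoc, pow_add]
    exact Ideal.mul_mem_mul (taylorPart_mem a m f) (sub_taylorPart_mem a hg)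
  rw [h, map_add, map_add, taylorValue_eq_zero a h1, taylorValue_eq_zero a h2, zero_add, zero_add,
    taylorPart, taylorPart, Finset.sum_mul_sum, taylorValue_apply a m, taylorValue_apply a n,
    Finset.sum_mul_sum, map_sum]
  refine Finset.sum_congr rfl fun k hk => ?_
  rw [map_sum]
  refine Finset.sum_congr rfl fun l hl => ?_
  rw [smul_mul_smul_comm, map_smul, shiftedMonomial_mul, taylorValue_shiftedMonomial, if_pos,
    smul_eq_mul]
  · ring
  · rw [← Finset.HasAntidiagonal.mem_antidiagonal.mp hk,
      ← Finset.HasAntidiagonal.mem_antidiagonal.mp hl]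
    ring

/-- To lowest order a multiplier acts through its value at `a`, which turns ideals into spans of
jets. -/
theorem mul_sub_smul_mem {n : ℕ} {f : MvPolynomial (Fin 2) K}
    (hf : f ∈ RingHom.ker (eval a) ^ n) (h : MvPolynomial (Fin 2) K) :
    h * f - jet a 0 0 h • f ∈ RingHom.ker (eval a) ^ (n + 1) := by
  have : h * f - jet a 0 0 h • f = (h - C (eval a h)) * f := by
    rw [jet_zero_zero, smul_eq_C_mul]; ring
  rw [this, pow_succ']
  exact Ideal.mul_mem_mul (by simp [RingHom.mem_ker]) hf

end Jets

/-! ### Colength of an ideal with two generators -/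

section Colength

variable {K : Type*} [Field K] (a : Fin 2 → K)

/-- The exponents of the monomials of degree less than `n` in two variables. -/
def lowExponents (n : ℕ) : Finset (ℕ × ℕ) :=
  (Finset.range n ×ˢ Finset.range n).filter fun k => k.1 + k.2 < n

theorem mem_lowExponents {n : ℕ} {k : ℕ × ℕ} : k ∈ lowExponents n ↔ k.1 + k.2 < n := by
  simp only [lowExponents, Finset.mem_filter, Finset.mem_product, Finset.mem_range]
  omega

/-- The Taylor coefficients at `a` in degrees less than `n`. -/
def lowJets (n : ℕ) : MvPolynomial (Fin 2) K →ₗ[K] (lowExponents n → K) :=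
  LinearMap.pi fun k => jet a k.1.1 k.1.2

theorem lowJets_eq_zero_iff {n : ℕ} {f : MvPolynomial (Fin 2) K} :
    lowJets a n f = 0 ↔ f ∈ RingHom.ker (eval a) ^ n := by
  rw [mem_ker_eval_pow_iff, funext_iff]
  exact ⟨fun h i j hij => h ⟨(i, j), mem_lowExponents.mpr hij⟩,
    fun h k => h _ _ (mem_lowExponents.mp k.2)⟩

/-- The polynomial of degree less than `n` with given Taylor coefficients. -/
def ofLowJets {n : ℕ} (c : lowExponents n → K) : MvPolynomial (Fin 2) K :=
  ∑ k, c k • shiftedMonomial a k.1.1 k.1.2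

theorem lowJets_ofLowJets {n : ℕ} (c : lowExponents n → K) :
    lowJets a n (ofLowJets a c) = c := by
  funext l
  simp only [lowJets, ofLowJets, LinearMap.pi_apply, map_sum, map_smul, jet_shiftedMonomial,
    smul_eq_mul, mul_ite, mul_one, mul_zero]
  rw [Finset.sum_eq_single l]
  · simp
  · intro k _ hkl
    exact if_neg fun h => hkl (Subtype.ext (Prod.ext h.1 h.2))
  · exact fun h => absurd (Finset.mem_univ l) h

theorem lowJets_mul {n : ℕ} {f : MvPolynomial (Fin 2) K}
    (hf : f ∈ RingHom.ker (eval a) ^ n) (h : MvPolynomial (Fin 2) K) :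
    lowJets a (n + 1) (h * f) = jet a 0 0 h • lowJets a (n + 1) f := by
  rw [← sub_eq_zero, ← map_smul, ← map_sub, lowJets_eq_zero_iff]
  exact mul_sub_smul_mem a hf h

theorem mem_sup_pow_iff {n : ℕ} {f g : MvPolynomial (Fin 2) K}
    (hf : f ∈ RingHom.ker (eval a) ^ n) (hg : g ∈ RingHom.ker (eval a) ^ n)
    (h : MvPolynomial (Fin 2) K) :
    h ∈ Ideal.span {f, g} ⊔ RingHom.ker (eval a) ^ (n + 1) ↔
      lowJets a (n + 1) h ∈ Submodule.span K {lowJets a (n + 1) f, lowJets a (n + 1) g} := by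
  rw [Submodule.mem_sup, Submodule.mem_span_pair]
  constructor
  · rintro ⟨i, hi, j, hj, rfl⟩
    obtain ⟨r, s, rfl⟩ := Ideal.mem_span_pair.mp hi
    refine ⟨jet a 0 0 r, jet a 0 0 s, ?_⟩
    rw [map_add, map_add, (lowJets_eq_zero_iff a).mpr hj, add_zero, lowJets_mul a hf,
      lowJets_mul a hg]
  · rintro ⟨r, s, hrs⟩
    refine ⟨C r * f + C s * g, Ideal.mem_span_pair.mpr ⟨_, _, rfl⟩, h - (C r * f + C s * g), ?_, ?_⟩
    · rw [← lowJets_eq_zero_iff, map_sub, ← hrs, ← smul_eq_C_mul, ← smul_eq_C_mul]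
      simp
    · ring

theorem ker_eval_isMaximal : (RingHom.ker (eval a)).IsMaximal :=
  RingHom.ker_isMaximal_of_surjective _ fun c => ⟨C c, eval_C c⟩

theorem toENat_rank_quotient_sup_pow {n : ℕ} {f g : MvPolynomial (Fin 2) K}
    (hf : f ∈ RingHom.ker (eval a) ^ n) (hg : g ∈ RingHom.ker (eval a) ^ n) {d : ℕ}
    (hd : Module.finrank K
      (Submodule.span K {lowJets a (n + 1) f, lowJets a (n + 1) g}) = d) :
    Cardinal.toENat (Module.rank K
      (MvPolynomial (Fin 2) K ⧸ (Ideal.span {f, g} ⊔ RingHom.ker (eval a) ^ (n + 1)))) =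
      ((lowExponents (n + 1)).card - d : ℕ) := by
  rw [toENat_rank_eq_finrank_quotient (lowJets a (n + 1))
    (fun c => ⟨_, lowJets_ofLowJets a c⟩) _ _ (mem_sup_pow_iff a hf hg),
    Submodule.finrank_quotient, hd, Module.finrank_fintype_fun_eq_card, Fintype.card_coe]

theorem finrank_quotient_span_pair_ge {V : Type*} [AddCommGroup V] [Module K V]
    [FiniteDimensional K V] (x y : V) :
    Module.finrank K V - 2 ≤ Module.finrank K (V ⧸ Submodule.span K {x, y}) := by
  classical
  have h : Module.finrank K (Submodule.span K {x, y}) ≤ 2 := by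
    have := finrank_span_finset_le_card (R := K) ({x, y} : Finset V)
    rw [Finset.coe_pair] at this
    exact this.trans Finset.card_le_two
  rw [Submodule.finrank_quotient]
  omega

/-- If two curves with a double point have a common tangent there, then they intersect with
multiplicity at least `5`. -/
theorem five_le_of_common_tangent {f g : MvPolynomial (Fin 2) K}
    (hf : f ∈ RingHom.ker (eval a) ^ 2) (hg : g ∈ RingHom.ker (eval a) ^ 2) {v w : K}
    (hvw : v ≠ 0 ∨ w ≠ 0) (hfv : taylorValue a 2 v w f = 0) (hgv : taylorValue a 2 v w g = 0) :
    5 ≤ Cardinal.toENat (Module.rank K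
      (MvPolynomial (Fin 2) K ⧸ (Ideal.span {f, g} ⊔ RingHom.ker (eval a) ^ 4))) := by
  -- `T` records the 2-jet, of dimension 6, and the cubic part at the common tangent direction. As
  -- both quadratic parts vanish there, linear multipliers contribute nothing, so `T` maps the ideal
  -- into a span of two vectors, of codimension at least `7 - 2 = 5`.
  set T := (lowJets a 3).prod (taylorValue a 3 v w) with hT
  have hmul : ∀ {f}, f ∈ RingHom.ker (eval a) ^ 2 → taylorValue a 2 v w f = 0 → ∀ h,
      T (h * f) = jet a 0 0 h • T f := by
    intro f hf hfv h
    rw [← sub_eq_zero, ← map_smul, ← map_sub]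
    have h1 : h * f - jet a 0 0 h • f = (h - C (eval a h)) * f := by
      rw [jet_zero_zero, smul_eq_C_mul]; ring
    have h2 : h - C (eval a h) ∈ RingHom.ker (eval a) ^ 1 := by simp [RingHom.mem_ker]
    refine Prod.ext ?_ ?_
    · exact (lowJets_eq_zero_iff a).mpr (mul_sub_smul_mem a hf h)
    · change taylorValue a 3 v w _ = 0
      rw [h1, show (3 : ℕ) = 1 + 2 from rfl, taylorValue_mul a h2 hf, hfv, mul_zero]
  have hcubic : ∃ h ∈ RingHom.ker (eval a) ^ 3, taylorValue a 3 v w h = 1 := by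
    rcases hvw with hv | hw
    · refine ⟨(v ^ 3)⁻¹ • shiftedMonomial a 3 0,
        Submodule.smul_of_tower_mem _ _ (shiftedMonomial_mem a 3 0), ?_⟩
      simp [taylorValue_shiftedMonomial, hv]
    · refine ⟨(w ^ 3)⁻¹ • shiftedMonomial a 0 3,
        Submodule.smul_of_tower_mem _ _ (shiftedMonomial_mem a 0 3), ?_⟩
      simp [taylorValue_shiftedMonomial, hw]
  have hsurj : Function.Surjective T := by
    rintro ⟨c, t⟩
    obtain ⟨h, hh, hh1⟩ := hcubic
    refine ⟨ofLowJets a c + (t - taylorValue a 3 v w (ofLowJets a c)) • h, ?_⟩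
    refine Prod.ext ?_ ?_
    · simp [hT, lowJets_ofLowJets, (lowJets_eq_zero_iff a).mpr hh]
    · simp [hT, hh1]
  have hmem : ∀ h ∈ Ideal.span {f, g} ⊔ RingHom.ker (eval a) ^ 4,
      T h ∈ Submodule.span K {T f, T g} := by
    intro h hh
    obtain ⟨i, hi, j, hj, rfl⟩ := Submodule.mem_sup.mp hh
    obtain ⟨r, s, rfl⟩ := Ideal.mem_span_pair.mp hi
    have hTj : T j = 0 := Prod.ext
      ((lowJets_eq_zero_iff a).mpr (Ideal.pow_le_pow_right (by norm_num) hj))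
      (taylorValue_eq_zero a hj v w)
    rw [Submodule.mem_span_pair]
    refine ⟨jet a 0 0 r, jet a 0 0 s, ?_⟩
    rw [map_add, map_add, hTj, add_zero, hmul hf hfv, hmul hg hgv]
  have hle := finrank_quotient_le_toENat_rank T hsurj _ _ hmem
  refine le_trans ?_ hle
  have h7 : Module.finrank K ((lowExponents 3 → K) × K) = 7 := by
    rw [Module.finrank_prod, Module.finrank_fintype_fun_eq_card, Fintype.card_coe,
      Module.finrank_self]
    rfl
  have := finrank_quotient_span_pair_ge (T f) (T g) (K := K)
  rw [h7] at this
  exact_mod_cast this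

end Colength

/-! ### Leading forms without a common zero -/

section Intersection

variable {K : Type*} [Field K] {a : Fin 2 → K} {f g : MvPolynomial (Fin 2) K}

theorem taylorValue_one (v w : K) :
    taylorValue a 1 v w f = v * jet a 1 0 f + w * jet a 0 1 f := by
  simp [taylorValue_apply, Finset.Nat.antidiagonal_succ, add_comm]

theorem taylorValue_two (v w : K) :
    taylorValue a 2 v w f =
      v ^ 2 * jet a 2 0 f + v * w * jet a 1 1 f + w ^ 2 * jet a 0 2 f := by
  simp [taylorValue_apply, Finset.Nat.antidiagonal_succ]
  ring

/-- The vector `(jet a 0 1 f, -jet a 1 0 f)` spans the tangent of `f` when `f` has a nonzero linear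
part. The value of the linear part of `g` there is, up to sign, the determinant of the two linear
parts. -/
theorem pow_le_of_transversal (hf : f ∈ RingHom.ker (eval a) ^ 1)
    (hg : g ∈ RingHom.ker (eval a) ^ 1)
    (h : taylorValue a 1 (jet a 0 1 f) (-jet a 1 0 f) g ≠ 0) :
    RingHom.ker (eval a) ^ 1 ≤ Ideal.span {f, g} ⊔ RingHom.ker (eval a) ^ 2 := by
  refine pow_le_of_shiftedMonomial_mem a le_sup_right ?_
  have hfI : f ∈ Ideal.span {f, g} := Ideal.subset_span (by simp)
  have hgI : g ∈ Ideal.span {f, g} := Ideal.subset_span (by simp)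
  have key := mem_of_det_ne_zero !![jet a 1 0 f, jet a 0 1 f; jet a 1 0 g, jet a 0 1 g] (by
      intro hd
      rw [Matrix.det_fin_two_of] at hd
      apply h
      rw [taylorValue_one]
      linear_combination -hd)
    (Ideal.span {f, g} ⊔ RingHom.ker (eval a) ^ 2)
    ![shiftedMonomial a 1 0, shiftedMonomial a 0 1] (by
      intro i
      fin_cases i
      · have := shiftedMonomial_mul_taylorPart_mem a hf hfI 0 0
        simpa [taylorPart, Finset.Nat.antidiagonal_succ, Fin.sum_univ_succ, shiftedMonomial_mul,
          add_comm, mul_add] using this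
      · have := shiftedMonomial_mul_taylorPart_mem a hg hgI 0 0
        simpa [taylorPart, Finset.Nat.antidiagonal_succ, Fin.sum_univ_succ, shiftedMonomial_mul,
          add_comm, mul_add] using this)
  intro k hk
  simp [Finset.Nat.antidiagonal_succ] at hk
  rcases hk with rfl | rfl
  · exact key 1
  · exact key 0

theorem pow_le_of_simple_double (hf : f ∈ RingHom.ker (eval a) ^ 1)
    (hg : g ∈ RingHom.ker (eval a) ^ 2)
    (h : taylorValue a 2 (jet a 0 1 f) (-jet a 1 0 f) g ≠ 0) :
    RingHom.ker (eval a) ^ 2 ≤ Ideal.span {f, g} ⊔ RingHom.ker (eval a) ^ 3 := by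
  refine pow_le_of_shiftedMonomial_mem a le_sup_right ?_
  have hfI : f ∈ Ideal.span {f, g} := Ideal.subset_span (by simp)
  have hgI : g ∈ Ideal.span {f, g} := Ideal.subset_span (by simp)
  -- The Sylvester matrix of a linear and a quadratic form. Its determinant is the quadratic form at
  -- the zero of the linear one.
  have key := mem_of_det_ne_zero !![jet a 1 0 f, jet a 0 1 f, 0; 0, jet a 1 0 f, jet a 0 1 f;
      jet a 2 0 g, jet a 1 1 g, jet a 0 2 g] (by
      intro hd
      rw [Matrix.det_fin_three] at hd
      apply h
      simp at hd
      rw [taylorValue_two]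
      linear_combination hd)
    (Ideal.span {f, g} ⊔ RingHom.ker (eval a) ^ 3)
    ![shiftedMonomial a 2 0, shiftedMonomial a 1 1, shiftedMonomial a 0 2] (by
      intro i
      fin_cases i
      · have := shiftedMonomial_mul_taylorPart_mem a hf hfI 1 0
        simpa [taylorPart, Finset.Nat.antidiagonal_succ, Fin.sum_univ_succ, shiftedMonomial_mul,
          add_comm, add_left_comm, add_assoc, mul_add] using this
      · have := shiftedMonomial_mul_taylorPart_mem a hf hfI 0 1
        simpa [taylorPart, Finset.Nat.antidiagonal_succ, Fin.sum_univ_succ, shiftedMonomial_mul,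
          add_comm, add_left_comm, add_assoc, mul_add] using this
      · have := shiftedMonomial_mul_taylorPart_mem a hg hgI 0 0
        simpa [taylorPart, Finset.Nat.antidiagonal_succ, Fin.sum_univ_succ, shiftedMonomial_mul,
          add_comm, add_left_comm, add_assoc, mul_add] using this)
  intro k hk
  simp [Finset.Nat.antidiagonal_succ] at hk
  rcases hk with rfl | rfl | rfl
  · exact key 2
  · exact key 1
  · exact key 0

theorem pow_le_of_double_double (hf : f ∈ RingHom.ker (eval a) ^ 2)
    (hg : g ∈ RingHom.ker (eval a) ^ 2) {p q r s : K} (h20 : jet a 2 0 f = p * r)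
    (h11 : jet a 1 1 f = p * s + q * r) (h02 : jet a 0 2 f = q * s)
    (h : taylorValue a 2 q (-p) g ≠ 0) (h' : taylorValue a 2 s (-r) g ≠ 0) :
    RingHom.ker (eval a) ^ 3 ≤ Ideal.span {f, g} ⊔ RingHom.ker (eval a) ^ 4 := by
  refine pow_le_of_shiftedMonomial_mem a le_sup_right ?_
  have hfI : f ∈ Ideal.span {f, g} := Ideal.subset_span (by simp)
  have hgI : g ∈ Ideal.span {f, g} := Ideal.subset_span (by simp)
  -- The Sylvester matrix of two quadratic forms. Its determinant is the product of the values of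
  -- the second at the zeros `(q, -p)` and `(s, -r)` of the first.
  have key := mem_of_det_ne_zero !![jet a 2 0 f, jet a 1 1 f, jet a 0 2 f, 0;
      0, jet a 2 0 f, jet a 1 1 f, jet a 0 2 f;
      jet a 2 0 g, jet a 1 1 g, jet a 0 2 g, 0;
      0, jet a 2 0 g, jet a 1 1 g, jet a 0 2 g] (by
      intro hd
      rw [Matrix.det_succ_row_zero] at hd
      simp [Fin.sum_univ_succ, Matrix.det_fin_three, Fin.succAbove] at hd
      rw [h20, h11, h02] at hd
      apply mul_ne_zero h h'
      rw [taylorValue_two, taylorValue_two]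
      linear_combination hd)
    (Ideal.span {f, g} ⊔ RingHom.ker (eval a) ^ 4)
    ![shiftedMonomial a 3 0, shiftedMonomial a 2 1, shiftedMonomial a 1 2, shiftedMonomial a 0 3] (by
      intro i
      fin_cases i
      · have := shiftedMonomial_mul_taylorPart_mem a hf hfI 1 0
        simpa [taylorPart, Finset.Nat.antidiagonal_succ, Fin.sum_univ_succ, shiftedMonomial_mul,
          add_comm, add_left_comm, add_assoc, mul_add] using this
      · have := shiftedMonomial_mul_taylorPart_mem a hf hfI 0 1
        simpa [taylorPart, Finset.Nat.antidiagonal_succ, Fin.sum_univ_succ, shiftedMonomial_mul,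
          add_comm, add_left_comm, add_assoc, mul_add] using this
      · have := shiftedMonomial_mul_taylorPart_mem a hg hgI 1 0
        simpa [taylorPart, Finset.Nat.antidiagonal_succ, Fin.sum_univ_succ, shiftedMonomial_mul,
          add_comm, add_left_comm, add_assoc, mul_add] using this
      · have := shiftedMonomial_mul_taylorPart_mem a hg hgI 0 1
        simpa [taylorPart, Finset.Nat.antidiagonal_succ, Fin.sum_univ_succ, shiftedMonomial_mul,
          add_comm, add_left_comm, add_assoc, mul_add] using this)
  intro k hk
  simp [Finset.Nat.antidiagonal_succ] at hk
  rcases hk with rfl | rfl | rfl | rfl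
  · exact key 3
  · exact key 2
  · exact key 1
  · exact key 0

end Intersection

/-! ### Intersection numbers of plane curves -/

section Plane

variable {K : Type*} [Field K] {p : Plane K} {f g : MvPolynomial (Fin 3) K}

instance pointIdeal_isMaximal (p : Plane K) : (pointIdeal p).IsMaximal :=
  ker_eval_isMaximal _

theorem intersectionNumber_eq (f g : MvPolynomial (Fin 3) K) (p : Plane K) :
    intersectionNumber f g p = Cardinal.toENat (Module.rank K (LocalRingAt p ⧸
      (Ideal.span {localEquation p f, localEquation p g}).map
        (algebraMap _ (LocalRingAt p)))) := by
  rw [intersectionNumber, Ideal.map_span, Set.image_pair]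

theorem intersectionNumber_eq_of_pow_le {n d : ℕ}
    (hf : localEquation p f ∈ RingHom.ker (eval p.affineCoord) ^ n)
    (hg : localEquation p g ∈ RingHom.ker (eval p.affineCoord) ^ n)
    (h : RingHom.ker (eval p.affineCoord) ^ (n + 1) ≤
      Ideal.span {localEquation p f, localEquation p g} ⊔
        RingHom.ker (eval p.affineCoord) ^ (n + 2))
    (hd : Module.finrank K (Submodule.span K {lowJets p.affineCoord (n + 1) (localEquation p f),
      lowJets p.affineCoord (n + 1) (localEquation p g)}) = d) :
    intersectionNumber f g p = ((lowExponents (n + 1)).card - d : ℕ) := by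
  rw [intersectionNumber_eq, toENat_rank_quotient_eq (pointIdeal p) (n := n + 1) h]
  exact toENat_rank_quotient_sup_pow _ hf hg hd

theorem eval_mul_of_isHomogeneous {σ : Type*} [Fintype σ] {f : MvPolynomial σ K} {n : ℕ}
    (hf : f.IsHomogeneous n) (c : K) (x : σ → K) :
    eval (fun i => c * x i) f = c ^ n * eval x f := by
  rw [eval_eq', eval_eq', Finset.mul_sum]
  refine Finset.sum_congr rfl fun d hd => ?_
  have h : ∑ i, d i = n := by
    rw [← Finsupp.degree_eq_sum, Finsupp.degree_eq_weight_one]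
    exact hf (mem_support_iff.mp hd)
  simp only [mul_pow, Finset.prod_mul_distrib, Finset.prod_pow_eq_pow_sum, h]
  ring

theorem eval_affineCoord_localEquation (f : MvPolynomial (Fin 3) K) :
    eval p.affineCoord (localEquation p f) = eval (fun i => (p.rep p.chart)⁻¹ * p.rep i) f := by
  have hp : p.rep p.chart ≠ 0 := p.exists_rep_ne_zero.choose_spec
  have h : ((aeval p.affineCoord).comp (localEquation p) : MvPolynomial (Fin 3) K →ₐ[K] K) =
      aeval (fun i => (p.rep p.chart)⁻¹ * p.rep i) := by
    ext i
    simp only [localEquation, AlgHom.comp_apply, aeval_X]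
    refine Fin.succAboveCases p.chart ?_ (fun j => ?_) i
    · simp [hp]
    · simp [Plane.affineCoord, div_eq_inv_mul]
  have := congrArg (fun φ => φ f) h
  simpa [aeval_eq_eval] using this

theorem intersectionNumber_eq_zero {n : ℕ} (hf : f.IsHomogeneous n) (h : ¬ PassesThrough f p) :
    intersectionNumber f g p = 0 := by
  have hp : p.rep p.chart ≠ 0 := p.exists_rep_ne_zero.choose_spec
  have hm : localEquation p f ∉ pointIdeal p := by
    rw [pointIdeal, RingHom.mem_ker, eval_affineCoord_localEquation, eval_mul_of_isHomogeneous hf]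
    exact mul_ne_zero (pow_ne_zero _ (inv_ne_zero hp)) h
  have hu : IsUnit (algebraMap _ (LocalRingAt p) (localEquation p f)) :=
    IsLocalization.map_units (LocalRingAt p) (⟨_, hm⟩ : (pointIdeal p).primeCompl)
  have ht : (Ideal.span {algebraMap _ (LocalRingAt p) (localEquation p f),
      algebraMap _ (LocalRingAt p) (localEquation p g)} : Ideal (LocalRingAt p)) = ⊤ :=
    Ideal.eq_top_of_isUnit_mem _ (Ideal.subset_span (by simp)) hu
  rw [intersectionNumber, ht, Cardinal.toENat_eq_zero]
  have : Subsingleton (LocalRingAt p ⧸ (⊤ : Ideal (LocalRingAt p))) :=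
    Ideal.Quotient.subsingleton_iff.mpr rfl
  exact rank_subsingleton' _ _

theorem intersectionNumber_eq_one (hf : localEquation p f ∈ pointIdeal p ^ 1)
    (hg : localEquation p g ∈ pointIdeal p ^ 1)
    (h : taylorValue p.affineCoord 1 (jet p.affineCoord 0 1 (localEquation p f))
      (-jet p.affineCoord 1 0 (localEquation p f)) (localEquation p g) ≠ 0) :
    intersectionNumber f g p = 1 := by
  -- Both constant terms vanish, so the dimension is `1 - 0`.
  rw [intersectionNumber_eq_of_pow_le (n := 0) (d := 0) (by simp) (by simp)
    (pow_le_of_transversal hf hg h)]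
  · rfl
  · rw [(lowJets_eq_zero_iff _).mpr hf, (lowJets_eq_zero_iff _).mpr hg]
    simp

theorem intersectionNumber_eq_two (hf : localEquation p f ∈ pointIdeal p ^ 1)
    (hg : localEquation p g ∈ pointIdeal p ^ 2)
    (h : taylorValue p.affineCoord 2 (jet p.affineCoord 0 1 (localEquation p f))
      (-jet p.affineCoord 1 0 (localEquation p f)) (localEquation p g) ≠ 0) :
    intersectionNumber f g p = 2 := by
  rw [intersectionNumber_eq_of_pow_le (n := 1) (d := 1) hf
    (Ideal.pow_le_pow_right one_le_two hg) (pow_le_of_simple_double hf hg h)]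
  · rfl
  -- Only `f` has a nonzero 1-jet, so the dimension is `3 - 1`.
  · rw [(lowJets_eq_zero_iff _).mpr hg, Set.pair_comm, Submodule.span_insert_zero]
    refine finrank_span_singleton fun h0 => h ?_
    have h0 := (lowJets_eq_zero_iff _).mp h0
    rw [jet_eq_zero_of_mem _ h0 (by norm_num), jet_eq_zero_of_mem _ h0 (by norm_num)]
    simp [taylorValue_two]

theorem intersectionNumber_eq_four (hf : localEquation p f ∈ pointIdeal p ^ 2)
    (hf' : localEquation p f ∉ pointIdeal p ^ 3)
    (hg : localEquation p g ∈ pointIdeal p ^ 2) {k l r s : K}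
    (h20 : jet p.affineCoord 2 0 (localEquation p f) = k * r)
    (h11 : jet p.affineCoord 1 1 (localEquation p f) = k * s + l * r)
    (h02 : jet p.affineCoord 0 2 (localEquation p f) = l * s)
    (h : taylorValue p.affineCoord 2 l (-k) (localEquation p g) ≠ 0)
    (h' : taylorValue p.affineCoord 2 s (-r) (localEquation p g) ≠ 0) :
    intersectionNumber f g p = 4 := by
  rw [intersectionNumber_eq_of_pow_le (n := 2) (d := 2) hf hg
    (pow_le_of_double_double hf hg h20 h11 h02 h h')]
  · rfl
  -- The dimension is `6 - 2` once the 2-jets are independent: evaluation at the zero `(l, -k)` of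
  -- the form of `f` kills the coefficient of `g`, and then `hf'` kills that of `f`.
  · have hli : LinearIndependent K ![lowJets p.affineCoord 3 (localEquation p f),
        lowJets p.affineCoord 3 (localEquation p g)] := by
      rw [LinearIndependent.pair_iff]
      intro x y hxy
      rw [← (lowJets p.affineCoord 3).map_smul, ← (lowJets p.affineCoord 3).map_smul, ← map_add,
        lowJets_eq_zero_iff] at hxy
      have hv := taylorValue_eq_zero _ hxy l (-k)
      have hfv : taylorValue p.affineCoord 2 l (-k) (localEquation p f) = 0 := by
        rw [taylorValue_two, h20, h11, h02]
        ring
      rw [map_add, map_smul, map_smul, hfv, smul_zero, zero_add, smul_eq_mul] at hv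
      have hy : y = 0 := (mul_eq_zero.mp hv).resolve_right h
      refine ⟨?_, hy⟩
      by_contra hx
      rw [hy, zero_smul, add_zero] at hxy
      apply hf'
      have := Submodule.smul_of_tower_mem _ x⁻¹ hxy
      rwa [smul_smul, inv_mul_cancel₀ hx, one_smul] at this
    have := finrank_span_eq_card hli
    rwa [Matrix.range_cons_cons_empty, Fintype.card_fin] at this

theorem taylorValue_ne_zero_of_intersectionNumber_eq_four
    (hf : localEquation p f ∈ pointIdeal p ^ 2) (hg : localEquation p g ∈ pointIdeal p ^ 2)
    (h : intersectionNumber f g p = 4) {v w : K} (hvw : v ≠ 0 ∨ w ≠ 0) :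
    taylorValue p.affineCoord 2 v w (localEquation p f) ≠ 0 ∨
      taylorValue p.affineCoord 2 v w (localEquation p g) ≠ 0 := by
  by_contra! hc
  have h5 := (five_le_of_common_tangent _ hf hg hvw hc.1 hc.2).trans
    (toENat_rank_quotient_le (K := K) (pointIdeal p) _ 4)
  rw [← intersectionNumber_eq, h] at h5
  exact absurd h5 (by decide)

/-! ### The general member of the pencil -/

theorem localEquation_pencilMember (f g : MvPolynomial (Fin 3) K) (c : K) :
    localEquation p (pencilMember f g c) = localEquation p f - c • localEquation p g := by
  simp [pencilMember]

theorem localEquation_pencilMember_mem {n : ℕ} (hf : localEquation p f ∈ pointIdeal p ^ n)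
    (hg : localEquation p g ∈ pointIdeal p ^ n) (c : K) :
    localEquation p (pencilMember f g c) ∈ pointIdeal p ^ n := by
  rw [localEquation_pencilMember]
  exact Ideal.sub_mem _ hf (Submodule.smul_of_tower_mem _ _ hg)

theorem eventually_sub_mul_ne_zero {x y : K} (h : x ≠ 0 ∨ y ≠ 0) :
    ∀ᶠ c in cofinite, x - c * y ≠ 0 := by
  by_cases hy : y = 0
  · exact Eventually.of_forall fun c => by simpa [hy] using h
  · filter_upwards [eventually_cofinite_ne (x / y)] with c hc h0
    exact hc (by rw [eq_div_iff hy]; linear_combination -h0)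

theorem eventually_taylorValue_pencilMember_ne_zero {n : ℕ} {v w : K}
    (h : taylorValue p.affineCoord n v w (localEquation p f) ≠ 0 ∨
      taylorValue p.affineCoord n v w (localEquation p g) ≠ 0) :
    ∀ᶠ c in cofinite,
      taylorValue p.affineCoord n v w (localEquation p (pencilMember f g c)) ≠ 0 := by
  filter_upwards [eventually_sub_mul_ne_zero h] with c hc
  rwa [localEquation_pencilMember, map_sub, map_smul, smul_eq_mul]

theorem IsSimplePoint.jet_ne_zero (h : IsSimplePoint f p) :
    jet p.affineCoord 1 0 (localEquation p f) ≠ 0 ∨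
      jet p.affineCoord 0 1 (localEquation p f) ≠ 0 := by
  by_contra! hc
  refine h.2 ((mem_ker_eval_pow_iff _).mpr fun i j hij => ?_)
  rcases Nat.lt_succ_iff_lt_or_eq.mp hij with hlt | heq
  · exact jet_eq_zero_of_mem _ h.1 hlt
  · rcases i with _ | _ | i
    · obtain rfl : j = 1 := by omega
      exact hc.2
    · obtain rfl : j = 0 := by omega
      exact hc.1
    · omega

theorem IsDoublePoint.jet_ne_zero (h : IsDoublePoint f p) :
    jet p.affineCoord 2 0 (localEquation p f) ≠ 0 ∨
      jet p.affineCoord 1 1 (localEquation p f) ≠ 0 ∨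
      jet p.affineCoord 0 2 (localEquation p f) ≠ 0 := by
  by_contra! hc
  refine h.2 ((mem_ker_eval_pow_iff _).mpr fun i j hij => ?_)
  rcases Nat.lt_succ_iff_lt_or_eq.mp hij with hlt | heq
  · exact jet_eq_zero_of_mem _ h.1 hlt
  · rcases i with _ | _ | _ | i
    · obtain rfl : j = 2 := by omega
      exact hc.2.2
    · obtain rfl : j = 1 := by omega
      exact hc.2.1
    · obtain rfl : j = 0 := by omega
      exact hc.1
    · omega

/-- Over an algebraically closed field, a binary quadratic form is a product of linear forms. -/
theorem exists_binary_quadratic_factor [IsAlgClosed K] (x y z : K) :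
    ∃ k l r s : K, x = k * r ∧ y = k * s + l * r ∧ z = l * s := by
  by_cases hx : x = 0
  · exact ⟨0, 1, y, z, by simp [hx], by ring, by ring⟩
  · obtain ⟨t, ht⟩ := IsAlgClosed.exists_root
      (Polynomial.C x * Polynomial.X ^ 2 + Polynomial.C y * Polynomial.X + Polynomial.C z)
      (by rw [Polynomial.degree_quadratic hx]; decide)
    simp only [Polynomial.IsRoot, Polynomial.eval_add, Polynomial.eval_mul, Polynomial.eval_C,
      Polynomial.eval_pow, Polynomial.eval_X] at ht
    exact ⟨1, -t, x, y + x * t, by ring, by ring, by linear_combination ht⟩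

theorem eventually_intersectionNumber_eq_two {q : MvPolynomial (Fin 3) K}
    (hf : IsDoublePoint f p) (hg : IsDoublePoint g p) (h4 : intersectionNumber f g p = 4)
    (hq : IsSimplePoint q p) :
    ∀ᶠ c in cofinite, intersectionNumber q (pencilMember f g c) p = 2 := by
  have hne := taylorValue_ne_zero_of_intersectionNumber_eq_four hf.1 hg.1 h4
    (hq.jet_ne_zero.symm.imp_right neg_ne_zero.mpr)
  filter_upwards [eventually_taylorValue_pencilMember_ne_zero hne] with c hc
  exact intersectionNumber_eq_two hq.1 (localEquation_pencilMember_mem hf.1 hg.1 c) hc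

theorem eventually_intersectionNumber_eq_four [IsAlgClosed K] {q : MvPolynomial (Fin 3) K}
    (hf : IsDoublePoint f p) (hg : IsDoublePoint g p) (h4 : intersectionNumber f g p = 4)
    (hq : IsDoublePoint q p) :
    ∀ᶠ c in cofinite, intersectionNumber q (pencilMember f g c) p = 4 := by
  obtain ⟨k, l, r, s, h20, h11, h02⟩ := exists_binary_quadratic_factor
    (jet p.affineCoord 2 0 (localEquation p q)) (jet p.affineCoord 1 1 (localEquation p q))
    (jet p.affineCoord 0 2 (localEquation p q))
  have hj := hq.jet_ne_zero
  rw [h20, h11, h02] at hj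
  -- Neither linear factor is zero, since the quadratic part of `q` is not; each therefore gives a
  -- genuine tangent direction.
  have hkl : l ≠ 0 ∨ -k ≠ 0 := by
    by_contra! hc
    rw [neg_eq_zero] at hc
    simp [hc.1, hc.2] at hj
  have hrs : s ≠ 0 ∨ -r ≠ 0 := by
    by_contra! hc
    rw [neg_eq_zero] at hc
    simp [hc.1, hc.2] at hj
  filter_upwards [
    eventually_taylorValue_pencilMember_ne_zero
      (taylorValue_ne_zero_of_intersectionNumber_eq_four hf.1 hg.1 h4 hkl),
    eventually_taylorValue_pencilMember_ne_zero
      (taylorValue_ne_zero_of_intersectionNumber_eq_four hf.1 hg.1 h4 hrs)] with c hc hc'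
  exact intersectionNumber_eq_four hq.1 hq.2 (localEquation_pencilMember_mem hf.1 hg.1 c)
    h20 h11 h02 hc hc'

/-- Curves with a common simple point whose linear terms there are dependent are tangent. -/
theorem tangentAt_of_taylorValue_eq_zero (hf : IsSimplePoint f p) (hg : IsSimplePoint g p)
    (h : taylorValue p.affineCoord 1 (jet p.affineCoord 0 1 (localEquation p f))
      (-jet p.affineCoord 1 0 (localEquation p f)) (localEquation p g) = 0) :
    TangentAt f g p := by
  have key : ∀ c, (jet p.affineCoord 1 0 (localEquation p f) =
      c * jet p.affineCoord 1 0 (localEquation p g)) →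
      (jet p.affineCoord 0 1 (localEquation p f) =
      c * jet p.affineCoord 0 1 (localEquation p g)) →
      localEquation p f - c • localEquation p g ∈ pointIdeal p ^ 2 := by
    intro c h10 h01
    refine (mem_ker_eval_pow_iff _).mpr fun i j hij => ?_
    rw [map_sub, map_smul, smul_eq_mul]
    rcases Nat.lt_succ_iff_lt_or_eq.mp hij with hlt | heq
    · rw [jet_eq_zero_of_mem _ hf.1 hlt, jet_eq_zero_of_mem _ hg.1 hlt, mul_zero, sub_zero]
    · rcases i with _ | _ | i
      · obtain rfl : j = 1 := by omega
        exact sub_eq_zero.mpr h01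
      · obtain rfl : j = 0 := by omega
        exact sub_eq_zero.mpr h10
      · omega
  rw [taylorValue_one] at h
  refine ⟨hf, hg, ?_⟩
  rcases hg.jet_ne_zero with h0 | h0
  · refine ⟨_ / _, key _ (div_mul_cancel₀ _ h0).symm ?_⟩
    field_simp
    linear_combination h
  · refine ⟨_ / _, key _ ?_ (div_mul_cancel₀ _ h0).symm⟩
    field_simp
    linear_combination -h

/-- If the linear parts of `f` and `g` both vanished along the tangent of `Q`, so would that of
every member, and `Q` would be tangent to all members with a simple point at `p`. -/
theorem eventually_intersectionNumber_eq_one {Q : PlaneCurve K}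
    (hfg : ∀ᶠ c in cofinite, IsSimplePoint (pencilMember f g c) p)
    (hf : localEquation p f ∈ pointIdeal p ^ 1) (hg : localEquation p g ∈ pointIdeal p ^ 1)
    (hQ : IsSimplePoint Q.form p) (hT : ¬ TangentToPencilAt f g Q p) :
    ∀ᶠ c in cofinite, intersectionNumber Q.form (pencilMember f g c) p = 1 := by
  have hne : taylorValue p.affineCoord 1 (jet p.affineCoord 0 1 (localEquation p Q.form))
        (-jet p.affineCoord 1 0 (localEquation p Q.form)) (localEquation p f) ≠ 0 ∨
      taylorValue p.affineCoord 1 (jet p.affineCoord 0 1 (localEquation p Q.form))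
        (-jet p.affineCoord 1 0 (localEquation p Q.form)) (localEquation p g) ≠ 0 := by
    by_contra! hc
    refine hT ?_
    filter_upwards [hfg] with c hs
    refine tangentAt_of_taylorValue_eq_zero hQ hs ?_
    rw [localEquation_pencilMember, map_sub, map_smul, hc.1, hc.2, smul_zero, sub_zero]
  filter_upwards [eventually_taylorValue_pencilMember_ne_zero hne] with c hc
  exact intersectionNumber_eq_one hQ.1 (localEquation_pencilMember_mem hf hg c) hc

theorem localEquation_mem_of_passesThrough {n : ℕ} (hf : f.IsHomogeneous n)
    (h : PassesThrough f p) : localEquation p f ∈ pointIdeal p ^ 1 := by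
  rw [pow_one, pointIdeal, RingHom.mem_ker, eval_affineCoord_localEquation,
    eval_mul_of_isHomogeneous hf, h, mul_zero]

end Plane

/-! ### Summation over the base-points -/

section Pencil

variable {K : Type*} [Field K] {F G : MvPolynomial (Fin 3) K} {b₀ : Plane K}
  {b : Fin 5 → Plane K}

/-- There are finitely many base-points, so one cofinite set of parameters serves them all: `b₀`
contributes `k`, each other base-point 1 if it lies on `Q` and 0 if not. -/
theorem IsDoublePointPencil.isInvolutionCurve (hP : IsDoublePointPencil F G b₀ b)
    (Q : PlaneCurve K) (hT : ∀ i, ¬ TangentToPencilAt F G Q (b i)) {k : ℕ}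
    (hk : ∀ᶠ c in cofinite, intersectionNumber Q.form (pencilMember F G c) b₀ = k)
    (hS : ∀ p ∈ basePointsOn F G Q \ {b₀}, IsSimplePoint Q.form p)
    (hd : k + (basePointsOn F G Q \ {b₀}).ncard + 1 = 3 * Q.degree) :
    IsInvolutionCurve F G Q := by
  classical
  have hfin : (basePoints F G).Finite := by
    rw [hP.basePoints_eq]
    exact (Set.finite_range b).insert b₀
  have hfin' : (basePoints F G \ {b₀}).Finite := hfin.subset Set.sdiff_subset
  have hone : ∀ᶠ c in cofinite, ∀ p ∈ basePointsOn F G Q \ {b₀},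
      intersectionNumber Q.form (pencilMember F G c) p = 1 := by
    refine (eventually_all_finite (hfin.subset fun p hp => hp.1.1)).mpr fun p hp => ?_
    have hpb : p ∈ insert b₀ (Set.range b) := hP.basePoints_eq ▸ hp.1.1
    obtain ⟨i, rfl⟩ := hpb.resolve_left hp.2
    exact eventually_intersectionNumber_eq_one (hP.simple i)
      (localEquation_mem_of_passesThrough hP.isHomogeneous_left hp.1.1.1)
      (localEquation_mem_of_passesThrough hP.isHomogeneous_right hp.1.1.2) (hS _ hp) (hT i)
  filter_upwards [hk, hone] with c hkc hc
  have hb₀ : b₀ ∈ basePoints F G := hP.basePoints_eq ▸ Set.mem_insert b₀ _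
  have hsum : ∑ᶠ p ∈ basePoints F G \ {b₀}, intersectionNumber Q.form (pencilMember F G c) p =
      ((basePointsOn F G Q \ {b₀}).ncard : ℕ∞) := by
    have hval : ∀ p ∈ hfin'.toFinset, intersectionNumber Q.form (pencilMember F G c) p =
        if p ∈ basePointsOn F G Q \ {b₀} then 1 else 0 := by
      intro p hp
      rw [Set.Finite.mem_toFinset] at hp
      split_ifs with h
      · exact hc p h
      · exact intersectionNumber_eq_zero Q.isHomogeneous fun hpQ => h ⟨⟨hp.1, hpQ⟩, hp.2⟩
    rw [finsum_mem_eq_finite_toFinset_sum _ hfin', Finset.sum_congr rfl hval, Finset.sum_boole,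
      ← Set.ncard_coe_finset]
    congr 2
    ext p
    simp only [Finset.coe_filter, Set.Finite.mem_toFinset, Set.mem_ofPred_eq]
    exact ⟨fun h => h.2, fun h => ⟨⟨h.1.1, h.2⟩, h⟩⟩
  have hins : basePoints F G = insert b₀ (basePoints F G \ {b₀}) := by
    rw [Set.insert_sdiff_singleton, Set.insert_eq_of_mem hb₀]
  rw [hins, finsum_mem_insert _ (fun h => h.2 rfl) hfin', hkc, hsum, ← hd]
  push_cast
  rfl

end Pencil

end

theorem proposition2 {K : Type*} [Field K] [IsAlgClosed K]
    (F G : MvPolynomial (Fin 3) K) (b₀ : Plane K) (b : Fin 5 → Plane K)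
    (hP : IsDoublePointPencil F G b₀ b) (Q : PlaneCurve K)
    (hT : ∀ i, ¬ TangentToPencilAt F G Q (b i))
    (hQ :
      (Q.degree = 1 ∧ IsSimplePoint Q.form b₀ ∧ basePointsOn F G Q = {b₀}) ∨
      (Q.degree = 1 ∧ b₀ ∉ basePointsOn F G Q ∧ (basePointsOn F G Q).ncard = 2 ∧
        ∀ p ∈ basePointsOn F G Q, IsSimplePoint Q.form p) ∨
      (Q.degree = 2 ∧ b₀ ∈ basePointsOn F G Q ∧ (basePointsOn F G Q).ncard = 4 ∧
        ∀ p ∈ basePointsOn F G Q, IsSimplePoint Q.form p) ∨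
      (Q.degree = 3 ∧ IsDoublePoint Q.form b₀ ∧ (basePointsOn F G Q \ {b₀}).ncard = 4 ∧
        ∀ p ∈ basePointsOn F G Q \ {b₀}, IsSimplePoint Q.form p)) :
    IsInvolutionCurve F G Q := by
  have hb₀ : b₀ ∈ basePoints F G := hP.basePoints_eq ▸ Set.mem_insert b₀ _
  have htwo := eventually_intersectionNumber_eq_two (q := Q.form) hP.double_left hP.double_right
    hP.intersectionNumber_double
  rcases hQ with ⟨hdeg, hs, hB⟩ | ⟨hdeg, hb, hcard, hs⟩ | ⟨hdeg, hb, hcard, hs⟩ |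
    ⟨hdeg, hdb, hcard, hs⟩
  -- The four counts, `b₀` first, are `2 + 0`, `0 + 2`, `2 + 3` and `4 + 4`; each is one less than
  -- three times the degree.
  · refine hP.isInvolutionCurve Q hT (k := 2) (htwo hs) ?_ ?_
    · simp [hB]
    · simp [hB, hdeg]
  · refine hP.isInvolutionCurve Q hT (k := 0) (Eventually.of_forall fun c => ?_)
      (fun p hp => hs p hp.1) ?_
    · exact intersectionNumber_eq_zero Q.isHomogeneous fun h => hb ⟨hb₀, h⟩
    · rw [Set.sdiff_singleton_eq_self hb, hcard, hdeg]
  · refine hP.isInvolutionCurve Q hT (k := 2) (htwo (hs b₀ hb)) (fun p hp => hs p hp.1) ?_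
    rw [Set.ncard_sdiff_singleton_of_mem hb, hcard, hdeg]
  · refine hP.isInvolutionCurve Q hT (k := 4) ?_ hs ?_
    · exact eventually_intersectionNumber_eq_four hP.double_left hP.double_right
        hP.intersectionNumber_double hdb
    · rw [hcard, hdeg]
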